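/- **Theorem (First hyperbolicity theorem).** Conventions. For points $x,y,z$ of a (pseudo-)metric space put $\langle y,z\rangle_x=\frac12\big(|x-y|+|x-z|-|y-z|\big)$; the space is *$\delta$-hyperbolic* if $\langle x,z\rangle_t\ge\min\{\langle x,y\rangle_t,\langle y,z\rangle_t\}-\delta$ for all points $x,y,z,t$. A subset $Y$ of a geodesic space $X$ is *$\alpha$-quasi-convex* if every geodesic of $X$ between two points of $Y$ is contained in the set of points at distance at most $\alpha$ from $Y$. If a group $H$ acts by isometries on a metric space $Y$, its *injectivity radius* on $Y$ is $\inf_{h\in H\setminus\{1\}}\inf_{y\in Y}|y-hy|$ (an infimum over the empty set is $+\infty$). Fix $r_0>0$. The *cone* $C(Y)$ over a metric space $Y$ is the quotient of $Y\times[0,r_0]$ in which all the points $(y,0)$ are identified, with the distance $$\big|(y,r)-(y',r')\big|=\operatorname{arccosh}\big(\cosh r\cosh r'-\sinh r\sinh r'\cos\theta(y,y')\big),\qquad \theta(y,y')=\min\Big\{\pi,\frac{|y-y'|}{\sinh r_0}\Big\}.$$ A group $H$ acting by isometries on $Y$ acts by isometries on $C(Y)$ by $h(y,r)=(hy,r)$,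 and the quotient $C(Y)/H$ carries the distance $|\bar x-\bar x'|=\inf_{h\in H}|x-hx'|$. Statement. Let $r_0>0$ and $\varepsilon>0$. There exists $\delta>0$, depending only on $r_0$ and $\varepsilon$, with the following property. Let $X$ be a geodesic $\delta$-hyperbolic metric space, $H$ a group acting by isometries on $X$, and $Y\subset X$ a $10\delta$-quasi-convex subset stabilized by $H$, with the metric induced from $X$. If the injectivity radius of $H$ on $Y$ is greater than $2\pi\sinh r_0$, then $C(Y)/H$ is $(\ln 3+\varepsilon)$-hyperbolic. -/

import Mathlib

noncomputable section

namespace HypCone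

open Real Set

/-! ### Hyperbolic spaces, geodesics, quasi-convexity -/

/-- The Gromov product of `y` and `z` with respect to the base point `x`. -/
def gromovProduct {X : Type*} [PseudoMetricSpace X] (y z x : X) : ℝ :=
  (dist x y + dist x z - dist y z) / 2

/-- `δ`-hyperbolicity, in the sense of the four point inequality. -/
def IsHyperbolic (δ : ℝ) (X : Type*) [PseudoMetricSpace X] : Prop :=
  ∀ x y z t : X,
    min (gromovProduct x y t) (gromovProduct y z t) - δ ≤ gromovProduct x z t

/-- `γ`, restricted to `[0, dist x y]`, is a geodesic from `x` to `y`
(the values of `γ` elsewhere are irrelevant). -/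
structure IsGeodesicFromTo {X : Type*} [PseudoMetricSpace X] (γ : ℝ → X) (x y : X) : Prop where
  source : γ 0 = x
  target : γ (dist x y) = y
  isometry : ∀ s ∈ Icc 0 (dist x y), ∀ t ∈ Icc 0 (dist x y), dist (γ s) (γ t) = |s - t|

/-- Any two points are joined by a geodesic. -/
def IsGeodesicSpace (X : Type*) [PseudoMetricSpace X] : Prop :=
  ∀ x y : X, ∃ γ : ℝ → X, IsGeodesicFromTo γ x y

/-- Every geodesic between two points of `Y` is contained in the (closed) `α`-neighbourhood
of `Y`, the set of points at distance at most `α` from `Y`. -/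
def IsQuasiConvex {X : Type*} [PseudoMetricSpace X] (α : ℝ) (Y : Set X) : Prop :=
  ∀ x ∈ Y, ∀ y ∈ Y, ∀ γ : ℝ → X, IsGeodesicFromTo γ x y →
    ∀ t ∈ Icc 0 (dist x y), γ t ∈ Metric.cthickening α Y

/-! ### Isometric actions -/

/-- The translation length `inf_x d(x, g x)` of `g` on `X` (`⊤` if `X` is empty). -/
def translationLength {H : Type*} (X : Type*) [PseudoMetricSpace X] [SMul H X] (g : H) :
    ENNReal :=
  ⨅ x : X, edist x (g • x)

/-- The injectivity radius of `H` on `X`, the infimum of the translation lengths of the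
nontrivial elements of `H` (`⊤` if there is no such element). -/
def injectivityRadius (H : Type*) (X : Type*) [Group H] [PseudoMetricSpace X] [SMul H X] :
    ENNReal :=
  ⨅ g : H, ⨅ _ : g ≠ 1, translationLength X g

/-- The restriction of an isometric action to an invariant subset is isometric. -/
instance isIsometricSMul_subMulAction {H X : Type*} [Group H] [PseudoMetricSpace X]
    [MulAction H X] [IsIsometricSMul H X] (Y : SubMulAction H X) : IsIsometricSMul H Y where
  isometry_smul h := by
    intro a b
    exact edist_smul_left h (a : X) (b : X)

/-- The quotient of `X` by the action of `G`. -/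
def OrbitSpace (G : Type*) (X : Type*) [Group G] [MulAction G X] : Type _ :=
  MulAction.orbitRel.Quotient G X

/-- The class of a point in the quotient. -/
def OrbitSpace.mk (G : Type*) {X : Type*} [Group G] [MulAction G X] (x : X) : OrbitSpace G X :=
  Quotient.mk (MulAction.orbitRel G X) x

theorem orbit_dist_bddBelow {G X : Type*} [Group G] [PseudoMetricSpace X] [MulAction G X]
    (x y : X) : BddBelow (range fun g : G => dist x (g • y)) :=
  ⟨0, by rintro _ ⟨g, rfl⟩; exact dist_nonneg⟩

theorem orbit_dist_congr {G X : Type*} [Group G] [PseudoMetricSpace X] [MulAction G X]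
    [IsIsometricSMul G X] (x y : X) (a b : G) :
    ⨅ g : G, dist (a • x) (g • (b • y)) = ⨅ g : G, dist x (g • y) := by
  refine Equiv.iInf_congr ((Equiv.mulLeft a⁻¹).trans (Equiv.mulRight b)) fun g => ?_
  simp only [Equiv.trans_apply, Equiv.coe_mulLeft, Equiv.coe_mulRight, mul_smul]
  rw [← dist_smul a]
  simp

/-- The quotient distance `inf_g d(x, g y)`. -/
def OrbitSpace.distFun (G : Type*) {X : Type*} [Group G] [PseudoMetricSpace X] [MulAction G X]
    [IsIsometricSMul G X] : OrbitSpace G X → OrbitSpace G X → ℝ :=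
  Quotient.lift₂ (fun x y => ⨅ g : G, dist x (g • y)) (by
    rintro _ _ x y ⟨a, rfl⟩ ⟨b, rfl⟩
    exact orbit_dist_congr x y a b)

/-- The quotient of a space by an isometric action, with the distance `inf_g d(x, g y)`. -/
instance {G X : Type*} [Group G] [PseudoMetricSpace X] [MulAction G X]
    [IsIsometricSMul G X] : PseudoMetricSpace (OrbitSpace G X) where
  dist := OrbitSpace.distFun G
  dist_self := by
    rintro ⟨x⟩
    refine le_antisymm ?_ (Real.iInf_nonneg fun g => dist_nonneg)
    refine (ciInf_le (orbit_dist_bddBelow x x) (1 : G)).trans ?_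
    simp
  dist_comm := by
    rintro ⟨x⟩ ⟨y⟩
    refine Equiv.iInf_congr (Equiv.inv G) fun g => ?_
    change dist y (g⁻¹ • x) = dist x (g • y)
    rw [← dist_smul g y, smul_inv_smul, dist_comm]
  dist_triangle := by
    rintro ⟨x⟩ ⟨y⟩ ⟨z⟩
    change (⨅ g : G, dist x (g • z)) ≤ (⨅ g : G, dist x (g • y)) + ⨅ g : G, dist y (g • z)
    refine le_ciInf_add_ciInf fun g h => ?_
    refine (ciInf_le (orbit_dist_bddBelow x z) (g * h)).trans ?_
    calc dist x ((g * h) • z) ≤ dist x (g • y) + dist (g • y) ((g * h) • z) :=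
          dist_triangle _ _ _
      _ = dist x (g • y) + dist y (h • z) := by rw [mul_smul, dist_smul]

theorem OrbitSpace.dist_mk {G X : Type*} [Group G] [PseudoMetricSpace X] [MulAction G X]
    [IsIsometricSMul G X] (x y : X) :
    dist (OrbitSpace.mk G x) (OrbitSpace.mk G y) = ⨅ g : G, dist x (g • y) := rfl

/-! ### The hyperbolic cone -/

/-- The points `(y, r)` with `r = 0` are all identified. -/
def coneSetoid (r₀ : ℝ) (Y : Type*) : Setoid (Y × Icc (0 : ℝ) r₀) where
  r p q := ((p.2 : ℝ) = 0 ∧ (q.2 : ℝ) = 0) ∨ p = q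
  iseqv :=
    { refl := fun _ => Or.inr rfl
      symm := by
        rintro p q (⟨h, h'⟩ | h)
        · exact Or.inl ⟨h', h⟩
        · exact Or.inr h.symm
      trans := by
        rintro p q s (⟨h, h'⟩ | rfl) (⟨k, k'⟩ | rfl)
        · exact Or.inl ⟨h, k'⟩
        · exact Or.inl ⟨h, h'⟩
        · exact Or.inl ⟨k, k'⟩
        · exact Or.inr rfl }

/-- The cone of radius `r₀` over `Y`. -/
def Cone (r₀ : ℝ) (Y : Type*) : Type _ := Quotient (coneSetoid r₀ Y)

/-- The point `(y, r)` of the cone. -/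
def Cone.mk {r₀ : ℝ} {Y : Type*} (y : Y) (r : Icc (0 : ℝ) r₀) : Cone r₀ Y :=
  Quotient.mk (coneSetoid r₀ Y) (y, r)

/-- The angle `min {π, d(y, y') / sinh r₀}`. -/
def coneAngle (r₀ : ℝ) {Y : Type*} [PseudoMetricSpace Y] (y y' : Y) : ℝ :=
  min π (dist y y' / sinh r₀)

/-- The hyperbolic cosine of the length of the third side of a hyperbolic triangle with two
sides of lengths `r`, `r'` enclosing the angle `θ`. -/
def coshSide (r r' θ : ℝ) : ℝ := cosh r * cosh r' - sinh r * sinh r' * cos θ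

/-- The distance on the cone. -/
def Cone.distFun {r₀ : ℝ} {Y : Type*} [PseudoMetricSpace Y] : Cone r₀ Y → Cone r₀ Y → ℝ :=
  Quotient.lift₂ (fun p q => arcosh (coshSide p.2 q.2 (coneAngle r₀ p.1 q.1))) (by
    rintro ⟨y, r⟩ ⟨z, s⟩ ⟨y', r'⟩ ⟨z', s'⟩ h k
    have h0 : (((r : ℝ) = 0 ∧ (r' : ℝ) = 0) ∨ (y, r) = (y', r')) := h
    have k0 : (((s : ℝ) = 0 ∧ (s' : ℝ) = 0) ∨ (z, s) = (z', s')) := k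
    rcases h0 with ⟨h1, h2⟩ | h1 <;> rcases k0 with ⟨k1, k2⟩ | k1
    · simp [coshSide, h1, h2, k1, k2]
    · obtain ⟨rfl, rfl⟩ := Prod.mk.inj k1
      simp [coshSide, h1, h2]
    · obtain ⟨rfl, rfl⟩ := Prod.mk.inj h1
      simp [coshSide, k1, k2]
    · obtain ⟨rfl, rfl⟩ := Prod.mk.inj k1
      obtain ⟨rfl, rfl⟩ := Prod.mk.inj h1
      rfl)

theorem one_le_coshSide {r r' : ℝ} (hr : 0 ≤ r) (hr' : 0 ≤ r') (θ : ℝ) :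
    1 ≤ coshSide r r' θ := by
  have h1 : 0 ≤ sinh r * sinh r' := mul_nonneg (sinh_nonneg_iff.2 hr) (sinh_nonneg_iff.2 hr')
  have h2 := one_le_cosh (r - r')
  rw [cosh_sub] at h2
  have h3 := mul_le_mul_of_nonneg_left (cos_le_one θ) h1
  unfold coshSide
  linarith

theorem coshSide_mono {r r' θ θ' : ℝ} (hr : 0 ≤ r) (hr' : 0 ≤ r') (h0 : 0 ≤ θ) (h : θ ≤ θ')
    (hπ : θ' ≤ π) : coshSide r r' θ ≤ coshSide r r' θ' := by
  have h1 : 0 ≤ sinh r * sinh r' := mul_nonneg (sinh_nonneg_iff.2 hr) (sinh_nonneg_iff.2 hr')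
  have h3 := mul_le_mul_of_nonneg_left (cos_le_cos_of_nonneg_of_le_pi h0 hπ h) h1
  unfold coshSide
  linarith

theorem coshSide_sq (r r' θ : ℝ) : coshSide r r' θ ^ 2 - 1 =
    (sinh r * sin θ) ^ 2 + (cosh r * sinh r' - sinh r * cosh r' * cos θ) ^ 2 := by
  have h1 := cosh_sq r
  have h2 := cosh_sq r'
  have h3 := sin_sq_add_cos_sq θ
  have h4 : sin θ ^ 2 = 1 - cos θ ^ 2 := by linarith
  unfold coshSide
  ring_nf
  rw [h1, h2, h4]
  ring

/-- The triangle inequality in the hyperbolic plane, in polar coordinates. -/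
theorem arcosh_coshSide_add {r s t : ℝ} (hr : 0 ≤ r) (hs : 0 ≤ s) (ht : 0 ≤ t) (α β : ℝ) :
    arcosh (coshSide r t (α + β)) ≤ arcosh (coshSide r s α) + arcosh (coshSide s t β) := by
  have hA := one_le_coshSide hr hs α
  have hB := one_le_coshSide hs ht β
  have hC := one_le_coshSide hr ht (α + β)
  have hA0 := arcosh_nonneg hA
  have hB0 := arcosh_nonneg hB
  rw [← arcosh_cosh (add_nonneg hA0 hB0),
    arcosh_le_arcosh (by linarith) (cosh_pos _), cosh_add, cosh_arcosh hA, cosh_arcosh hB]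
  have hcs : (sinh r * sin α) * (sinh t * sin β) -
      (cosh r * sinh s - sinh r * cosh s * cos α) * (cosh t * sinh s - sinh t * cosh s * cos β)
      ≤ sinh (arcosh (coshSide r s α)) * sinh (arcosh (coshSide s t β)) := by
    rw [sinh_arcosh hA, sinh_arcosh hB, ← sqrt_mul (by nlinarith)]
    apply le_sqrt_of_sq_le
    have hBs : coshSide s t β = coshSide t s β := by unfold coshSide; ring
    rw [hBs, coshSide_sq, coshSide_sq]
    nlinarith [sq_nonneg ((sinh r * sin α) * (cosh t * sinh s - sinh t * cosh s * cos β) +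
      (cosh r * sinh s - sinh r * cosh s * cos α) * (sinh t * sin β))]
  refine le_trans (le_of_eq ?_) (add_le_add_right hcs _)
  have h1 : cosh s ^ 2 = sinh s ^ 2 + 1 := cosh_sq s
  unfold coshSide
  rw [cos_add]
  ring_nf
  rw [h1]
  ring

theorem coneAngle_nonneg {r₀ : ℝ} (h : 0 ≤ r₀) {Y : Type*} [PseudoMetricSpace Y] (y y' : Y) :
    0 ≤ coneAngle r₀ y y' :=
  le_min pi_pos.le (div_nonneg dist_nonneg (sinh_nonneg_iff.2 h))

/-- The cone with the distance
`d((y, r), (y', r')) = arcosh (cosh r cosh r' - sinh r sinh r' cos θ(y, y'))`. -/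
instance {r₀ : ℝ} {Y : Type*} [MetricSpace Y] : MetricSpace (Cone r₀ Y) where
  dist := Cone.distFun
  dist_self := by
    rintro ⟨y, r, hr⟩
    have h : cosh r * cosh r - sinh r * sinh r = 1 := by
      have := cosh_sq r
      nlinarith
    change arcosh (coshSide r r (coneAngle r₀ y y)) = 0
    simp [coshSide, coneAngle, pi_pos.le, h]
  dist_comm := by
    rintro ⟨y, r⟩ ⟨y', r'⟩
    change arcosh (coshSide r r' (coneAngle r₀ y y')) = arcosh (coshSide r' r (coneAngle r₀ y' y))
    unfold coneAngle coshSide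
    rw [dist_comm y y']
    ring_nf
  dist_triangle := by
    rintro ⟨y, r, hr, hr'⟩ ⟨z, s, hs, -⟩ ⟨w, t, ht, -⟩
    change arcosh (coshSide r t (coneAngle r₀ y w)) ≤
      arcosh (coshSide r s (coneAngle r₀ y z)) + arcosh (coshSide s t (coneAngle r₀ z w))
    have h0 : 0 ≤ r₀ := hr.trans hr'
    have a0 := coneAngle_nonneg h0 y z
    have b0 := coneAngle_nonneg h0 z w
    have c0 := coneAngle_nonneg h0 y w
    have aπ : coneAngle r₀ y z ≤ π := min_le_left _ _
    have bπ : coneAngle r₀ z w ≤ π := min_le_left _ _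
    have cπ : coneAngle r₀ y w ≤ π := min_le_left _ _
    have tri : coneAngle r₀ y w ≤ coneAngle r₀ y z + coneAngle r₀ z w := by
      have h1 : 0 ≤ dist y z / sinh r₀ := div_nonneg dist_nonneg (sinh_nonneg_iff.2 h0)
      have h2 : 0 ≤ dist z w / sinh r₀ := div_nonneg dist_nonneg (sinh_nonneg_iff.2 h0)
      have h3 : dist y w / sinh r₀ ≤ dist y z / sinh r₀ + dist z w / sinh r₀ := by
        rw [← add_div]
        exact div_le_div_of_nonneg_right (dist_triangle _ _ _) (sinh_nonneg_iff.2 h0)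
      have h4 := pi_pos
      unfold coneAngle
      rcases min_choice π (dist y z / sinh r₀) with h | h <;>
      rcases min_choice π (dist z w / sinh r₀) with k | k <;>
      rw [h, k] <;>
      first
      | exact (min_le_left _ _).trans (by linarith)
      | exact (min_le_right _ _).trans (by linarith)
    set a := coneAngle r₀ y z
    set b := coneAngle r₀ z w
    set c := coneAngle r₀ y w
    have ha' : min a (π - b) ≤ a := min_le_left _ _
    have ha0 : 0 ≤ min a (π - b) := le_min a0 (by linarith)
    have hc : c ≤ min a (π - b) + b := by
      rcases min_choice a (π - b) with h | h <;> rw [h] <;> linarith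
    have hsum : min a (π - b) + b ≤ π := by
      have := min_le_right a (π - b)
      linarith
    have p := one_le_coshSide hr ht
    have q := one_le_coshSide hr hs
    have e1 : arcosh (coshSide r t c) ≤ arcosh (coshSide r t (min a (π - b) + b)) :=
      (arcosh_le_arcosh (by linarith [p c]) (by linarith [p (min a (π - b) + b)])).2
        (coshSide_mono hr ht c0 hc hsum)
    have e2 : arcosh (coshSide r s (min a (π - b))) ≤ arcosh (coshSide r s a) :=
      (arcosh_le_arcosh (by linarith [q (min a (π - b))]) (by linarith [q a])).2
        (coshSide_mono hr hs ha0 ha' aπ)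
    have e3 := arcosh_coshSide_add hr hs ht (min a (π - b)) b
    linarith
  eq_of_dist_eq_zero := by
    rintro ⟨y, r, hr, hr'⟩ ⟨z, s, hs, hs'⟩ h
    have h : arcosh (coshSide r s (coneAngle r₀ y z)) = 0 := h
    have h0 : 0 ≤ r₀ := hr.trans hr'
    rw [arcosh_eq_zero_iff (one_le_coshSide hr hs _)] at h
    have h1 : 0 ≤ sinh r * sinh s := mul_nonneg (sinh_nonneg_iff.2 hr) (sinh_nonneg_iff.2 hs)
    have h2 := one_le_cosh (r - s)
    have h3 := mul_nonneg h1 (sub_nonneg.2 (cos_le_one (coneAngle r₀ y z)))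
    unfold coshSide at h
    rw [cosh_sub] at h2
    have h4 : cosh (r - s) = 1 := by rw [cosh_sub]; linarith
    have h5 : r = s := by
      by_contra hne
      have := one_lt_cosh.2 (sub_ne_zero.2 hne)
      linarith
    subst h5
    apply Quotient.sound
    rcases hr.eq_or_lt with h6 | h6
    · exact Or.inl ⟨h6.symm, h6.symm⟩
    · have h7 : 0 < sinh r := sinh_pos_iff.2 h6
      have h8 : sinh r * sinh r * (1 - cos (coneAngle r₀ y z)) = 0 := by linarith
      have h9 : cos (coneAngle r₀ y z) = 1 := by
        rcases mul_eq_zero.1 h8 with h10 | h10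
        · exact absurd h10 (mul_pos h7 h7).ne'
        · linarith
      have h11 : coneAngle r₀ y z = 0 := by
        have b0 := coneAngle_nonneg h0 y z
        have bπ : coneAngle r₀ y z ≤ π := min_le_left _ _
        exact (cos_eq_one_iff_of_lt_of_lt (by linarith [pi_pos]) (by linarith [pi_pos])).1 h9
      have h12 : 0 < sinh r₀ := sinh_pos_iff.2 (h6.trans_le hr')
      have h13 : dist y z / sinh r₀ = 0 := by
        unfold coneAngle at h11
        rcases min_choice π (dist y z / sinh r₀) with h14 | h14 <;> rw [h14] at h11
        · exact absurd h11 pi_pos.ne'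
        · exact h11
      have h15 : y = z := dist_eq_zero.1 ((div_eq_zero_iff.1 h13).resolve_right h12.ne')
      subst h15
      exact Or.inr rfl

theorem Cone.dist_mk {r₀ : ℝ} {Y : Type*} [MetricSpace Y] (y y' : Y) (r r' : Icc (0 : ℝ) r₀) :
    dist (Cone.mk y r) (Cone.mk y' r') = arcosh (cosh r * cosh r' -
      sinh r * sinh r' * cos (min π (dist y y' / sinh r₀))) := rfl

/-- The action of `H` on the cone, `h (y, r) = (h y, r)`. -/
instance {r₀ : ℝ} {H Y : Type*} [Group H] [MulAction H Y] : MulAction H (Cone r₀ Y) where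
  smul h := Quotient.map (fun p => (h • p.1, p.2)) (by
    rintro p q (hpq | rfl)
    · exact Or.inl hpq
    · exact Or.inr rfl)
  one_smul := by
    rintro ⟨y, r⟩
    change Cone.mk ((1 : H) • y) r = Cone.mk y r
    rw [one_smul]
  mul_smul := by
    rintro a b ⟨y, r⟩
    change Cone.mk ((a * b) • y) r = Cone.mk (a • b • y) r
    rw [mul_smul]

theorem Cone.smul_mk {r₀ : ℝ} {H Y : Type*} [Group H] [MulAction H Y] (h : H) (y : Y)
    (r : Icc (0 : ℝ) r₀) : h • Cone.mk y r = Cone.mk (h • y) r := rfl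

instance {r₀ : ℝ} {H Y : Type*} [Group H] [MetricSpace Y] [MulAction H Y]
    [IsIsometricSMul H Y] : IsIsometricSMul H (Cone r₀ Y) where
  isometry_smul h := by
    refine Isometry.of_dist_eq ?_
    rintro ⟨y, r⟩ ⟨y', r'⟩
    change dist (Cone.mk (h • y) r) (Cone.mk (h • y') r') = dist (Cone.mk y r) (Cone.mk y' r')
    rw [Cone.dist_mk, Cone.dist_mk, dist_smul]

end HypCone

end

/-! In four-point form, hyperbolicity compares the sum of two diagonals of a quadrilateral with sums
of opposite sides. The quotient `C(Y)/H` is the cone over `Y/H` (`dist_mk_cone_mk`). Since `Y/H` may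
be only pseudo-metric, its cone is handled through the function `coneDist`.

A quadrilateral of perimeter below `2π sinh r₀` in `Y/H` lifts, up to arbitrarily small error, to a
closed quadrilateral in `Y`: otherwise a nontrivial element would move a point too little. It
therefore inherits the inequality of `Y` (`OrbitSpace.four_point`).

In the cone, quadrilaterals are compared with planar ones. If the side angles add up to at least
`2π`, they shrink to a closed quadrilateral around the origin of the hyperbolic plane with no longer
sides and no shorter diagonals. Otherwise no side angle is truncated at `π`, the base inequality
applies, and the angles unroll onto a line with diagonals kept and sides lengthened by at most `δ /
sinh r₀`, which costs at most `δ` per side in the plane.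

The plane contributes `log 3`, by Ptolemy's inequality for `sinh (d / 2)`. The total is `log 3 + δ`,
so `δ = ε` works. -/

namespace HypCone

open Real Set

/-! ### The four point inequality in the hyperbolic plane -/

/-- The distance of two points of the hyperbolic plane given by polar coordinates. -/
noncomputable def polarDist (p q : ℝ × ℝ) : ℝ := arcosh (coshSide p.1 q.1 (p.2 - q.2))

theorem polarDist_comm (p q : ℝ × ℝ) : polarDist p q = polarDist q p := by
  unfold polarDist coshSide
  rw [← cos_neg (p.2 - q.2), neg_sub]
  ring_nf

theorem polarDist_nonneg {p q : ℝ × ℝ} (hp : 0 ≤ p.1) (hq : 0 ≤ q.1) : 0 ≤ polarDist p q :=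
  arcosh_nonneg (one_le_coshSide hp hq _)

theorem polarDist_triangle {p q s : ℝ × ℝ} (hp : 0 ≤ p.1) (hq : 0 ≤ q.1) (hs : 0 ≤ s.1) :
    polarDist p s ≤ polarDist p q + polarDist q s := by
  have h := arcosh_coshSide_add hp hq hs (p.2 - q.2) (q.2 - s.2)
  rwa [sub_add_sub_cancel] at h

/-- The numerator of `sinh (d(p, q) / 2)` in the disc model. -/
noncomputable def polarBracket (p q : ℝ × ℝ) : ℂ :=
  (cosh (q.1 / 2) : ℂ) * (sinh (p.1 / 2) * Complex.exp (p.2 * Complex.I)) -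
    cosh (p.1 / 2) * (sinh (q.1 / 2) * Complex.exp (q.2 * Complex.I))

/-- The bracket is the determinant of the homogeneous coordinates `(sinh (r/2) e^{iφ}, cosh (r/2))`
of the disc points `tanh (r/2) e^{iφ}`. The identity follows from the half-argument formulas. -/
theorem coshSide_eq_polarBracket (p q : ℝ × ℝ) :
    coshSide p.1 q.1 (p.2 - q.2) = 1 + 2 * ‖polarBracket p q‖ ^ 2 := by
  obtain ⟨r, φ⟩ := p
  obtain ⟨s, ψ⟩ := q
  have e : polarBracket (r, φ) (s, ψ) =
      ⟨cosh (s / 2) * (sinh (r / 2) * cos φ) - cosh (r / 2) * (sinh (s / 2) * cos ψ),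
        cosh (s / 2) * (sinh (r / 2) * sin φ) - cosh (r / 2) * (sinh (s / 2) * sin ψ)⟩ := by
    unfold polarBracket
    apply Complex.ext <;>
    simp [-Complex.ofReal_cosh, -Complex.ofReal_sinh, Complex.exp_ofReal_mul_I_re,
      Complex.exp_ofReal_mul_I_im]
  rw [e, ← Complex.normSq_eq_norm_sq, Complex.normSq_mk]
  have hr : r = 2 * (r / 2) := by ring
  have hs : s = 2 * (s / 2) := by ring
  unfold coshSide
  simp only
  rw [cos_sub]
  conv_lhs => rw [hr, hs]
  rw [cosh_two_mul, cosh_two_mul, sinh_two_mul, sinh_two_mul]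
  have h1 := cosh_sq (r / 2)
  have h2 := cosh_sq (s / 2)
  have h3 := sin_sq φ
  have h4 := sin_sq ψ
  generalize r / 2 = r at *
  generalize s / 2 = s at *
  ring_nf
  rw [h1, h2, h3, h4]
  ring

theorem norm_polarBracket {p q : ℝ × ℝ} (hp : 0 ≤ p.1) (hq : 0 ≤ q.1) :
    ‖polarBracket p q‖ = sinh (polarDist p q / 2) := by
  have h1 : cosh (polarDist p q) = 1 + 2 * ‖polarBracket p q‖ ^ 2 := by
    rw [polarDist, cosh_arcosh (one_le_coshSide hp hq _), coshSide_eq_polarBracket]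
  have h2 : polarDist p q = 2 * (polarDist p q / 2) := by ring
  rw [h2, cosh_two_mul, cosh_sq] at h1
  have h3 : 0 ≤ sinh (polarDist p q / 2) :=
    sinh_nonneg_iff.2 (by linarith [polarDist_nonneg hp hq])
  exact (pow_left_inj₀ (norm_nonneg _) h3 two_ne_zero).1 (by linarith)

/-- Ptolemy's inequality in the hyperbolic plane. -/
theorem polarDist_ptolemy {p₁ p₂ p₃ p₄ : ℝ × ℝ} (h₁ : 0 ≤ p₁.1) (h₂ : 0 ≤ p₂.1)
    (h₃ : 0 ≤ p₃.1) (h₄ : 0 ≤ p₄.1) :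
    sinh (polarDist p₁ p₃ / 2) * sinh (polarDist p₂ p₄ / 2) ≤
      sinh (polarDist p₁ p₂ / 2) * sinh (polarDist p₃ p₄ / 2) +
        sinh (polarDist p₁ p₄ / 2) * sinh (polarDist p₂ p₃ / 2) := by
  rw [← norm_polarBracket h₁ h₃, ← norm_polarBracket h₂ h₄, ← norm_polarBracket h₁ h₂,
    ← norm_polarBracket h₃ h₄, ← norm_polarBracket h₁ h₄, ← norm_polarBracket h₂ h₃,
    ← norm_mul, ← norm_mul, ← norm_mul]
  -- Plücker relation for 2 × 2 determinants: `[13][24] = [12][34] + [14][23]`.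
  refine le_trans (le_of_eq (congrArg norm ?_)) (norm_add_le _ _)
  unfold polarBracket
  ring

theorem sinh_half_mul_sinh_half (a b : ℝ) :
    sinh (a / 2) * sinh (b / 2) = (cosh ((a + b) / 2) - cosh ((a - b) / 2)) / 2 := by
  rw [add_div a b, sub_div a b, cosh_add, cosh_sub]
  ring

/-- The hyperbolic plane is `log 3`-hyperbolic. -/
theorem polarDist_four_point {p₁ p₂ p₃ p₄ : ℝ × ℝ} (h₁ : 0 ≤ p₁.1) (h₂ : 0 ≤ p₂.1)
    (h₃ : 0 ≤ p₃.1) (h₄ : 0 ≤ p₄.1) :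
    polarDist p₁ p₃ + polarDist p₂ p₄ ≤
      max (polarDist p₁ p₂ + polarDist p₃ p₄) (polarDist p₁ p₄ + polarDist p₂ p₃) +
        2 * log 3 := by
  have pt := polarDist_ptolemy h₁ h₂ h₃ h₄
  have t1 := polarDist_triangle h₁ h₂ h₃
  have t2 := polarDist_triangle h₂ h₄ h₃
  have t3 := polarDist_triangle h₂ h₁ h₄
  have t4 := polarDist_triangle h₁ h₃ h₄
  rw [polarDist_comm p₄ p₃] at t2
  rw [polarDist_comm p₂ p₁] at t3
  have n12 := polarDist_nonneg h₁ h₂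
  have n34 := polarDist_nonneg h₃ h₄
  set a := polarDist p₁ p₃
  set b := polarDist p₂ p₄
  set c := polarDist p₁ p₂
  set d := polarDist p₃ p₄
  set e := polarDist p₁ p₄
  set f := polarDist p₂ p₃
  set m := max (c + d) (e + f) / 2 with hm
  have hm1 : (c + d) / 2 ≤ m := div_le_div_of_nonneg_right (le_max_left _ _) two_pos.le
  have hm2 : (e + f) / 2 ≤ m := div_le_div_of_nonneg_right (le_max_right _ _) two_pos.le
  have hm0 : 0 ≤ m := by linarith
  have hcd : -m ≤ (c + d) / 2 := by linarith
  have hef : -m ≤ (e + f) / 2 := by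
    have := polarDist_nonneg h₁ h₄
    have := polarDist_nonneg h₂ h₃
    linarith
  have k1 : cosh ((c + d) / 2) ≤ cosh m :=
    cosh_le_cosh.2 (by rw [abs_of_nonneg hm0]; exact abs_le.2 ⟨hcd, hm1⟩)
  have k2 : cosh ((e + f) / 2) ≤ cosh m :=
    cosh_le_cosh.2 (by rw [abs_of_nonneg hm0]; exact abs_le.2 ⟨hef, hm2⟩)
  -- The four triangle inequalities give `|a - b| ≤ c + d ≤ 2 m`.
  have k3 : cosh ((a - b) / 2) ≤ cosh m :=
    cosh_le_cosh.2 (by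
      rw [abs_of_nonneg hm0]
      exact abs_le.2 ⟨by linarith, by linarith⟩)
  rw [sinh_half_mul_sinh_half, sinh_half_mul_sinh_half, sinh_half_mul_sinh_half] at pt
  have k4 := one_le_cosh ((c - d) / 2)
  have k5 := one_le_cosh ((e - f) / 2)
  have key : cosh ((a + b) / 2) ≤ 3 * cosh m - 2 := by linarith
  -- The two sides share the term `3 e^m / 2`; the remaining excess `4 e^{-m} / 3` is absorbed by
  -- the `2`.
  have k6 : 3 * cosh m - 2 ≤ cosh (m + log 3) := by
    rw [cosh_eq, cosh_eq, neg_add, Real.exp_add, Real.exp_add, Real.exp_neg (log 3),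
      Real.exp_log three_pos]
    have : Real.exp (-m) ≤ 1 := Real.exp_le_one_iff.2 (by linarith)
    linarith
  have hl : 0 ≤ log 3 := log_nonneg (by norm_num)
  have k7 := cosh_le_cosh.1 (key.trans k6)
  rw [abs_of_nonneg (by linarith : 0 ≤ m + log 3)] at k7
  have := (le_abs_self _).trans k7
  linarith

/-- Moving a point at radius at most `r₀` by an angle `η` moves it by at most `η * sinh r₀`. -/
theorem arcosh_coshSide_self_le {r r₀ η : ℝ} (hr : 0 ≤ r) (h : r ≤ r₀) :
    arcosh (coshSide r r η) ≤ sinh r₀ * |η| := by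
  have h0 := one_le_coshSide hr hr η
  have hs : sinh r ≤ sinh r₀ := sinh_le_sinh.2 h
  have hr' : 0 ≤ sinh r := sinh_nonneg_iff.2 hr
  have h1 : 0 ≤ sinh r₀ * |η| := mul_nonneg (hr'.trans hs) (abs_nonneg _)
  rw [← arcosh_cosh h1, arcosh_le_arcosh (by linarith) (cosh_pos _)]
  have h2 : coshSide r r η = 1 + sinh r ^ 2 * (1 - cos η) := by
    unfold coshSide
    have := cosh_sq r
    nlinarith
  have h3 : 1 - cos η ≤ η ^ 2 / 2 := by linarith [one_sub_sq_div_two_le_cos (x := η)]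
  have h4 : sinh r ^ 2 * (1 - cos η) ≤ sinh r₀ ^ 2 * (η ^ 2 / 2) :=
    mul_le_mul (pow_le_pow_left₀ hr' hs 2) h3 (by linarith [cos_le_one η]) (sq_nonneg _)
  have h5 : 1 + (sinh r₀ * |η|) ^ 2 / 2 ≤ cosh (sinh r₀ * |η|) := by
    have h6 : cosh (sinh r₀ * |η|) = 1 + 2 * sinh (sinh r₀ * |η| / 2) ^ 2 := by
      conv_lhs => rw [show sinh r₀ * |η| = 2 * (sinh r₀ * |η| / 2) by ring]
      rw [cosh_two_mul, cosh_sq]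
      ring
    have h7 := pow_le_pow_left₀ (by linarith) (self_le_sinh_iff.2 (by linarith :
      0 ≤ sinh r₀ * |η| / 2)) 2
    linarith
  rw [mul_pow, sq_abs] at h5
  linarith

/-- Angles enter only through their cosine, so planar comparison points may carry arbitrary real
angles, not reduced modulo `2π`. -/
theorem arcosh_coshSide_le_of_cos_le {r s θ φ : ℝ} (hr : 0 ≤ r) (hs : 0 ≤ s)
    (h : cos φ ≤ cos θ) : arcosh (coshSide r s θ) ≤ arcosh (coshSide r s φ) := by
  have h1 : 0 ≤ sinh r * sinh s := mul_nonneg (sinh_nonneg_iff.2 hr) (sinh_nonneg_iff.2 hs)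
  rw [arcosh_le_arcosh (by linarith [one_le_coshSide hr hs θ])
    (by linarith [one_le_coshSide hr hs φ])]
  have := mul_le_mul_of_nonneg_left h h1
  unfold coshSide
  linarith

/-- Rotating the first point by at most `η` brings the angle back into `[-θ, θ]`; the triangle
inequality charges `sinh r₀ * η` for the rotation. -/
theorem arcosh_coshSide_le_add {r s r₀ θ φ η : ℝ} (hr : 0 ≤ r) (h : r ≤ r₀) (hs : 0 ≤ s)
    (hθ : 0 ≤ θ) (hπ : θ ≤ π) (hη : 0 ≤ η) (hφ : |φ| ≤ θ + η) :
    arcosh (coshSide r s φ) ≤ arcosh (coshSide r s θ) + sinh r₀ * η := by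
  obtain ⟨ψ, h1, h2⟩ : ∃ ψ, |ψ| ≤ θ ∧ |φ - ψ| ≤ η := by
    obtain ⟨h3, h4⟩ := abs_le.1 hφ
    -- `ψ` is `φ` clamped to `[-θ, θ]`.
    refine ⟨max (-θ) (min θ φ), abs_le.2 ⟨le_max_left _ _, ?_⟩, abs_le.2 ⟨?_, ?_⟩⟩
    · exact max_le (by linarith) (min_le_left _ _)
    · have : max (-θ) (min θ φ) ≤ φ + η :=
        max_le (by linarith) ((min_le_right _ _).trans (by linarith))
      linarith
    · have : φ - η ≤ max (-θ) (min θ φ) :=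
        (le_min (by linarith) (by linarith)).trans (le_max_right _ _)
      linarith
  have h3 := arcosh_coshSide_add hr hr hs (φ - ψ) ψ
  rw [sub_add_cancel] at h3
  have h4 : arcosh (coshSide r s ψ) ≤ arcosh (coshSide r s θ) := by
    refine arcosh_coshSide_le_of_cos_le hr hs ?_
    rw [← cos_abs ψ]
    exact cos_le_cos_of_nonneg_of_le_pi (abs_nonneg _) hπ h1
  have h5 := arcosh_coshSide_self_le (η := φ - ψ) hr h
  have h6 := mul_le_mul_of_nonneg_left h2 (sinh_nonneg_iff.2 (hr.trans h))
  linarith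

/-! ### Planar comparison quadrilaterals -/

/-- The sums fill `[a + c, b + d]`, and two intervals meet once each starts before the other ends.
-/
theorem exists_add_mem_Icc {a b c d e f : ℝ} (hab : a ≤ b) (hcd : c ≤ d) (hef : e ≤ f)
    (h1 : a + c ≤ f) (h2 : e ≤ b + d) : ∃ u ∈ Icc a b, ∃ v ∈ Icc c d, u + v ∈ Icc e f := by
  have k1 : a + c ≤ max (a + c) e := le_max_left _ _
  have k2 : e ≤ max (a + c) e := le_max_right _ _
  have k3 : max (a + c) e ≤ f := max_le h1 hef
  have k4 : max (a + c) e ≤ b + d := max_le (by linarith) h2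
  set v := max (a + c) e
  rcases min_cases b (v - c) with ⟨-, h⟩ | ⟨-, h⟩
  · exact ⟨b, ⟨hab, le_rfl⟩, v - b, ⟨by linarith, by linarith⟩, by linarith, by linarith⟩
  · exact ⟨v - c, ⟨by linarith, by linarith⟩, c, ⟨le_rfl, hcd⟩, by linarith, by linarith⟩

/-- Four angles of total at least `2 π` can be shrunk to a closed quadrilateral on the circle
whose diagonals are at least as long as prescribed. -/
theorem exists_circle_quadrilateral {θ₁ θ₂ θ₃ θ₄ A B : ℝ} (h₁ : 0 ≤ θ₁) (h₂ : 0 ≤ θ₂)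
    (h₃ : 0 ≤ θ₃) (h₄ : 0 ≤ θ₄) (hA : A ≤ π) (hB : B ≤ π) (hA0 : 0 ≤ A)
    (hA₁ : A ≤ θ₁ + θ₂) (hA₂ : A ≤ θ₃ + θ₄) (hB₁ : B ≤ θ₂ + θ₃) (hB₂ : B ≤ θ₄ + θ₁)
    (hsum : 2 * π ≤ θ₁ + θ₂ + θ₃ + θ₄) :
    ∃ α₁ ∈ Icc 0 θ₁, ∃ α₂ ∈ Icc 0 θ₂, ∃ α₃ ∈ Icc 0 θ₃, ∃ α₄ ∈ Icc 0 θ₄,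
      α₁ + α₂ + α₃ + α₄ = 2 * π ∧ α₁ + α₂ ∈ Icc A (2 * π - A) ∧
        α₂ + α₃ ∈ Icc B (2 * π - B) := by
  -- `s` will be `α₁ + α₂`, the position of the third vertex. The bounds involving `B` leave room
  -- for the second diagonal.
  obtain ⟨s, s1, s2, s3, s4, s5, s6, s7, s8⟩ : ∃ s, A ≤ s ∧ 2 * π - θ₃ - θ₄ ≤ s ∧ B - θ₃ ≤ s ∧
      B - θ₄ ≤ s ∧ s ≤ 2 * π - A ∧ s ≤ θ₁ + θ₂ ∧ s ≤ 2 * π - B + θ₂ ∧ s ≤ 2 * π - B + θ₁ := by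
    refine ⟨max (max A (2 * π - θ₃ - θ₄)) (max (B - θ₃) (B - θ₄)),
      (le_max_left _ _).trans (le_max_left _ _), (le_max_right _ _).trans (le_max_left _ _),
      (le_max_left _ _).trans (le_max_right _ _), (le_max_right _ _).trans (le_max_right _ _),
      ?_, ?_, ?_, ?_⟩ <;>
    refine max_le (max_le ?_ ?_) (max_le ?_ ?_) <;> linarith
  have hs : s ≤ 2 * π := by linarith
  -- With `s` fixed, `u = α₁` and `v = α₄` vary independently, and `u + v = 2π - (α₂ + α₃)` has to
  -- lie in `[B, 2π - B]`.
  obtain ⟨u, ⟨u1, u2⟩, v, ⟨v1, v2⟩, w1, w2⟩ := exists_add_mem_Icc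
    (a := max 0 (s - θ₂)) (b := min θ₁ s) (c := max 0 (2 * π - s - θ₃)) (d := min θ₄ (2 * π - s))
    (e := B) (f := 2 * π - B)
    (by refine max_le (le_min ?_ ?_) (le_min ?_ ?_) <;> linarith)
    (by refine max_le (le_min ?_ ?_) (le_min ?_ ?_) <;> linarith) (by linarith)
    (by rcases max_choice 0 (s - θ₂) with h | h <;>
        rcases max_choice 0 (2 * π - s - θ₃) with k | k <;> rw [h, k] <;> linarith)
    (by rcases min_choice θ₁ s with h | h <;>
        rcases min_choice θ₄ (2 * π - s) with k | k <;> rw [h, k] <;> linarith)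
  obtain ⟨u1, u1'⟩ := max_le_iff.1 u1
  obtain ⟨v1, v1'⟩ := max_le_iff.1 v1
  obtain ⟨u2, u2'⟩ := le_min_iff.1 u2
  obtain ⟨v2, v2'⟩ := le_min_iff.1 v2
  refine ⟨u, ⟨u1, u2⟩, s - u, ⟨?_, ?_⟩, 2 * π - s - v, ⟨?_, ?_⟩, v, ⟨v1, v2⟩, ?_, ⟨?_, ?_⟩,
    ?_, ?_⟩ <;> linarith

/-- Four points satisfying one half of the four point condition up to `2 η` map to the line, with
diagonals preserved and sides increased by at most `η`. -/
theorem exists_line_quadrilateral {θ₁₂ θ₂₃ θ₃₄ θ₁₄ A B η : ℝ} (hη : 0 ≤ η)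
    (hA : 0 ≤ A) (hB : 0 ≤ B) (h₁₂ : 0 ≤ θ₁₂) (h₂₃ : 0 ≤ θ₂₃) (h₃₄ : 0 ≤ θ₃₄) (h₁₄ : 0 ≤ θ₁₄)
    (hA₁ : A ≤ θ₁₂ + θ₂₃) (hA₂ : A ≤ θ₃₄ + θ₁₄) (hB₁ : B ≤ θ₂₃ + θ₃₄) (hB₂ : B ≤ θ₁₄ + θ₁₂)
    (hAB : A ≤ θ₁₂ + B + θ₃₄) (hBA : B ≤ θ₁₂ + A + θ₃₄) (h : A + B ≤ θ₁₄ + θ₂₃ + 2 * η) :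
    ∃ x, |x| ≤ θ₁₂ + η ∧ |x - A| ≤ θ₂₃ + η ∧ |x + B| ≤ θ₁₄ + η ∧ |x + B - A| ≤ θ₃₄ + η := by
  -- The vertices sit at `0, x, A, x + B`, so `x` must lie in four intervals centred at `0`, `A`,
  -- `-B`, `A - B`. Intervals meeting pairwise have a common point, namely the largest left
  -- endpoint. Only the pair centred at `A` and `-B` needs the four-point hypothesis `h`.
  refine ⟨max (max (-θ₁₂ - η) (A - θ₂₃ - η)) (max (-B - θ₁₄ - η) (A - B - θ₃₄ - η)), ?_⟩
  have k1 := le_max_left (max (-θ₁₂ - η) (A - θ₂₃ - η)) (max (-B - θ₁₄ - η) (A - B - θ₃₄ - η))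
  have k2 := le_max_right (max (-θ₁₂ - η) (A - θ₂₃ - η)) (max (-B - θ₁₄ - η) (A - B - θ₃₄ - η))
  obtain ⟨a1, a2⟩ := max_le_iff.1 k1
  obtain ⟨a3, a4⟩ := max_le_iff.1 k2
  have up : ∀ c, -θ₁₂ - η ≤ c → A - θ₂₃ - η ≤ c → -B - θ₁₄ - η ≤ c → A - B - θ₃₄ - η ≤ c →
      max (max (-θ₁₂ - η) (A - θ₂₃ - η)) (max (-B - θ₁₄ - η) (A - B - θ₃₄ - η)) ≤ c :=
    fun c c1 c2 c3 c4 => max_le (max_le c1 c2) (max_le c3 c4)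
  have b1 := up (θ₁₂ + η) (by linarith) (by linarith) (by linarith) (by linarith)
  have b2 := up (A + θ₂₃ + η) (by linarith) (by linarith) (by linarith) (by linarith)
  have b3 := up (θ₁₄ + η - B) (by linarith) (by linarith) (by linarith) (by linarith)
  have b4 := up (θ₃₄ + η + A - B) (by linarith) (by linarith) (by linarith) (by linarith)
  refine ⟨abs_le.2 ⟨?_, ?_⟩, abs_le.2 ⟨?_, ?_⟩, abs_le.2 ⟨?_, ?_⟩, abs_le.2 ⟨?_, ?_⟩⟩ <;> linarith

theorem cos_le_cos_of_mem_Icc {A s : ℝ} (hA : 0 ≤ A) (hs : s ∈ Icc A (2 * π - A)) :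
    cos s ≤ cos A := by
  rcases le_total s π with h | h
  · exact cos_le_cos_of_nonneg_of_le_pi hA h hs.1
  · rw [← cos_two_pi_sub s]
    exact cos_le_cos_of_nonneg_of_le_pi hA (by linarith) (by linarith [hs.2])

/-! ### The four point inequality in a cone -/

theorem coneAngle_comm (r₀ : ℝ) {Z : Type*} [PseudoMetricSpace Z] (x y : Z) :
    coneAngle r₀ x y = coneAngle r₀ y x := by
  unfold coneAngle
  rw [dist_comm]

theorem coneAngle_triangle {r₀ : ℝ} (h0 : 0 ≤ r₀) {Z : Type*} [PseudoMetricSpace Z] (x y z : Z) :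
    coneAngle r₀ x z ≤ coneAngle r₀ x y + coneAngle r₀ y z := by
  have hs := sinh_nonneg_iff.2 h0
  have h1 : 0 ≤ dist x y / sinh r₀ := div_nonneg dist_nonneg hs
  have h2 : 0 ≤ dist y z / sinh r₀ := div_nonneg dist_nonneg hs
  have h3 : dist x z / sinh r₀ ≤ dist x y / sinh r₀ + dist y z / sinh r₀ := by
    rw [← add_div]
    exact div_le_div_of_nonneg_right (dist_triangle _ _ _) hs
  have h4 := pi_pos
  unfold coneAngle
  rcases min_choice π (dist x y / sinh r₀) with h | h <;>
  rcases min_choice π (dist y z / sinh r₀) with k | k <;>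
  rw [h, k] <;>
  first
  | exact (min_le_left _ _).trans (by linarith)
  | exact (min_le_right _ _).trans (by linarith)

/-- The distance of the cone over a pseudo-metric space, in coordinates. -/
noncomputable def coneDist {r₀ : ℝ} {Z : Type*} [PseudoMetricSpace Z]
    (p q : Z × Icc (0 : ℝ) r₀) : ℝ :=
  arcosh (coshSide p.2 q.2 (coneAngle r₀ p.1 q.1))

section ConeDist

variable {r₀ : ℝ} {Z : Type*} [PseudoMetricSpace Z]

theorem coneDist_comm (p q : Z × Icc (0 : ℝ) r₀) : coneDist p q = coneDist q p := by
  unfold coneDist coshSide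
  rw [coneAngle_comm]
  ring_nf

theorem coneDist_le_polarDist {p q : Z × Icc (0 : ℝ) r₀} {φ ψ : ℝ}
    (h : cos (φ - ψ) ≤ cos (coneAngle r₀ p.1 q.1)) :
    coneDist p q ≤ polarDist (p.2, φ) (q.2, ψ) :=
  arcosh_coshSide_le_of_cos_le p.2.2.1 q.2.2.1 h

theorem polarDist_le_coneDist {p q : Z × Icc (0 : ℝ) r₀} {φ ψ : ℝ}
    (h : cos (coneAngle r₀ p.1 q.1) ≤ cos (φ - ψ)) :
    polarDist (p.2, φ) (q.2, ψ) ≤ coneDist p q :=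
  arcosh_coshSide_le_of_cos_le p.2.2.1 q.2.2.1 h

theorem polarDist_le_coneDist_add {p q : Z × Icc (0 : ℝ) r₀} {φ ψ η : ℝ} (hη : 0 ≤ η)
    (h : |φ - ψ| ≤ coneAngle r₀ p.1 q.1 + η) :
    polarDist (p.2, φ) (q.2, ψ) ≤ coneDist p q + sinh r₀ * η :=
  arcosh_coshSide_le_add p.2.2.1 p.2.2.2 q.2.2.1
    (coneAngle_nonneg (p.2.2.1.trans p.2.2.2) _ _) (min_le_left _ _) hη h

/-- The four point inequality for quadrilaterals that go around the apex. -/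
theorem coneDist_four_point_of_two_pi_le (p₁ p₂ p₃ p₄ : Z × Icc (0 : ℝ) r₀)
    (h : 2 * π ≤ coneAngle r₀ p₁.1 p₂.1 + coneAngle r₀ p₂.1 p₃.1 + coneAngle r₀ p₃.1 p₄.1 +
      coneAngle r₀ p₄.1 p₁.1) :
    coneDist p₁ p₃ + coneDist p₂ p₄ ≤
      max (coneDist p₁ p₂ + coneDist p₃ p₄) (coneDist p₁ p₄ + coneDist p₂ p₃) + 2 * log 3 := by
  have h0 : 0 ≤ r₀ := p₁.2.2.1.trans p₁.2.2.2
  have nn : ∀ x y : Z, 0 ≤ coneAngle r₀ x y := coneAngle_nonneg h0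
  have lp : ∀ x y : Z, coneAngle r₀ x y ≤ π := fun x y => min_le_left _ _
  have tri : ∀ x y z : Z, coneAngle r₀ x z ≤ coneAngle r₀ x y + coneAngle r₀ y z :=
    coneAngle_triangle h0
  have t1 := tri p₃.1 p₄.1 p₁.1
  have t2 := tri p₄.1 p₁.1 p₂.1
  rw [coneAngle_comm r₀ p₃.1 p₁.1] at t1
  rw [coneAngle_comm r₀ p₄.1 p₂.1] at t2
  obtain ⟨α₁, a1, α₂, a2, α₃, a3, α₄, a4, hs, hA, hB⟩ := exists_circle_quadrilateral
    (nn p₁.1 p₂.1) (nn p₂.1 p₃.1) (nn p₃.1 p₄.1) (nn p₄.1 p₁.1) (lp p₁.1 p₃.1) (lp p₂.1 p₄.1)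
    (nn _ _) (tri _ _ _) t1 (tri _ _ _) t2 h
  have side : ∀ {α : ℝ} {x y : Z}, α ∈ Icc 0 (coneAngle r₀ x y) →
      cos (coneAngle r₀ x y) ≤ cos α := fun hα =>
    cos_le_cos_of_nonneg_of_le_pi hα.1 (lp _ _) hα.2
  have key := polarDist_four_point (p₁ := (p₁.2, 0)) (p₂ := (p₂.2, α₁)) (p₃ := (p₃.2, α₁ + α₂))
    (p₄ := (p₄.2, α₁ + α₂ + α₃)) p₁.2.2.1 p₂.2.2.1 p₃.2.2.1 p₄.2.2.1
  have d13 : coneDist p₁ p₃ ≤ polarDist (p₁.2, 0) (p₃.2, α₁ + α₂) := by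
    refine coneDist_le_polarDist ?_
    rw [zero_sub, cos_neg]
    exact cos_le_cos_of_mem_Icc (nn _ _) hA
  have d24 : coneDist p₂ p₄ ≤ polarDist (p₂.2, α₁) (p₄.2, α₁ + α₂ + α₃) := by
    refine coneDist_le_polarDist ?_
    rw [show α₁ - (α₁ + α₂ + α₃) = -(α₂ + α₃) by ring, cos_neg]
    exact cos_le_cos_of_mem_Icc (nn _ _) hB
  have d12 : polarDist (p₁.2, 0) (p₂.2, α₁) ≤ coneDist p₁ p₂ := by
    refine polarDist_le_coneDist ?_
    rw [zero_sub, cos_neg]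
    exact side a1
  have d23 : polarDist (p₂.2, α₁) (p₃.2, α₁ + α₂) ≤ coneDist p₂ p₃ := by
    refine polarDist_le_coneDist ?_
    rw [show α₁ - (α₁ + α₂) = -α₂ by ring, cos_neg]
    exact side a2
  have d34 : polarDist (p₃.2, α₁ + α₂) (p₄.2, α₁ + α₂ + α₃) ≤ coneDist p₃ p₄ := by
    refine polarDist_le_coneDist ?_
    rw [show α₁ + α₂ - (α₁ + α₂ + α₃) = -α₃ by ring, cos_neg]
    exact side a3
  have d14 : polarDist (p₁.2, 0) (p₄.2, α₁ + α₂ + α₃) ≤ coneDist p₁ p₄ := by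
    refine polarDist_le_coneDist ?_
    -- The closing side is the remaining arc `α₄` of the full turn.
    rw [show 0 - (α₁ + α₂ + α₃) = α₄ - 2 * π by linarith, cos_sub_two_pi, coneAngle_comm]
    exact side a4
  have := max_le_max (add_le_add d12 d34) (add_le_add d14 d23)
  linarith

/-- The four point inequality for quadrilaterals whose angles satisfy one half of the four point
condition up to an error. -/
theorem coneDist_four_point_of_angle_le (p₁ p₂ p₃ p₄ : Z × Icc (0 : ℝ) r₀) {η : ℝ} (hη : 0 ≤ η)
    (h : coneAngle r₀ p₁.1 p₃.1 + coneAngle r₀ p₂.1 p₄.1 ≤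
      coneAngle r₀ p₁.1 p₄.1 + coneAngle r₀ p₂.1 p₃.1 + 2 * η) :
    coneDist p₁ p₃ + coneDist p₂ p₄ ≤
      max (coneDist p₁ p₂ + coneDist p₃ p₄) (coneDist p₁ p₄ + coneDist p₂ p₃) +
        2 * (log 3 + sinh r₀ * η) := by
  have h0 : 0 ≤ r₀ := p₁.2.2.1.trans p₁.2.2.2
  have nn : ∀ x y : Z, 0 ≤ coneAngle r₀ x y := coneAngle_nonneg h0
  have tri : ∀ x y z : Z, coneAngle r₀ x z ≤ coneAngle r₀ x y + coneAngle r₀ y z :=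
    coneAngle_triangle h0
  have c : ∀ x y : Z, coneAngle r₀ x y = coneAngle r₀ y x := coneAngle_comm r₀
  obtain ⟨x, x1, x2, x3, x4⟩ := exists_line_quadrilateral hη (nn p₁.1 p₃.1) (nn p₂.1 p₄.1)
    (nn p₁.1 p₂.1) (nn p₂.1 p₃.1) (nn p₃.1 p₄.1) (nn p₁.1 p₄.1) (tri _ _ _)
    (by linarith [tri p₁.1 p₄.1 p₃.1, c p₄.1 p₃.1]) (tri _ _ _)
    (by linarith [tri p₂.1 p₁.1 p₄.1, c p₂.1 p₁.1])
    (by linarith [tri p₁.1 p₂.1 p₃.1, tri p₂.1 p₄.1 p₃.1, c p₄.1 p₃.1])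
    (by linarith [tri p₂.1 p₁.1 p₄.1, tri p₁.1 p₃.1 p₄.1, c p₂.1 p₁.1]) h
  set A := coneAngle r₀ p₁.1 p₃.1 with hA
  set B := coneAngle r₀ p₂.1 p₄.1 with hB
  have key := polarDist_four_point (p₁ := (p₁.2, 0)) (p₂ := (p₂.2, x)) (p₃ := (p₃.2, A))
    (p₄ := (p₄.2, x + B)) p₁.2.2.1 p₂.2.2.1 p₃.2.2.1 p₄.2.2.1
  have d13 : coneDist p₁ p₃ ≤ polarDist (p₁.2, 0) (p₃.2, A) := by
    refine coneDist_le_polarDist ?_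
    rw [zero_sub, cos_neg]
  have d24 : coneDist p₂ p₄ ≤ polarDist (p₂.2, x) (p₄.2, x + B) := by
    refine coneDist_le_polarDist ?_
    rw [sub_add_cancel_left, cos_neg]
  have d12 : polarDist (p₁.2, 0) (p₂.2, x) ≤ coneDist p₁ p₂ + sinh r₀ * η :=
    polarDist_le_coneDist_add hη (by rwa [zero_sub, abs_neg])
  have d23 : polarDist (p₂.2, x) (p₃.2, A) ≤ coneDist p₂ p₃ + sinh r₀ * η :=
    polarDist_le_coneDist_add hη x2
  have d34 : polarDist (p₃.2, A) (p₄.2, x + B) ≤ coneDist p₃ p₄ + sinh r₀ * η :=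
    polarDist_le_coneDist_add hη (by rwa [abs_sub_comm])
  have d14 : polarDist (p₁.2, 0) (p₄.2, x + B) ≤ coneDist p₁ p₄ + sinh r₀ * η :=
    polarDist_le_coneDist_add hη (by rwa [zero_sub, abs_neg])
  have := max_le_max (add_le_add d12 d34) (add_le_add d14 d23)
  have e : ∀ a b : ℝ, a + sinh r₀ * η + (b + sinh r₀ * η) = a + b + 2 * (sinh r₀ * η) :=
    fun a b => by ring
  rw [e, e, max_add_add_right] at this
  linarith

/-- If quadrilaterals of perimeter less than `2 π sinh r₀` in `Z` satisfy the four point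
inequality, then the cone over `Z` satisfies a four point inequality. -/
theorem coneDist_four_point (h0 : 0 < r₀) {δ : ℝ} (hδ : 0 ≤ δ)
    (hZ : ∀ z₁ z₂ z₃ z₄ : Z,
      dist z₁ z₂ + dist z₂ z₃ + dist z₃ z₄ + dist z₄ z₁ < 2 * π * sinh r₀ →
      dist z₁ z₃ + dist z₂ z₄ ≤
        max (dist z₁ z₂ + dist z₃ z₄) (dist z₁ z₄ + dist z₂ z₃) + 2 * δ)
    (p₁ p₂ p₃ p₄ : Z × Icc (0 : ℝ) r₀) :
    coneDist p₁ p₃ + coneDist p₂ p₄ ≤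
      max (coneDist p₁ p₂ + coneDist p₃ p₄) (coneDist p₁ p₄ + coneDist p₂ p₃) +
        2 * (log 3 + δ) := by
  have hs : 0 < sinh r₀ := sinh_pos_iff.2 h0
  rcases le_or_gt (2 * π) (coneAngle r₀ p₁.1 p₂.1 + coneAngle r₀ p₂.1 p₃.1 +
    coneAngle r₀ p₃.1 p₄.1 + coneAngle r₀ p₄.1 p₁.1) with h | h
  · linarith [coneDist_four_point_of_two_pi_le p₁ p₂ p₃ p₄ h]
  have tri : ∀ x y z : Z, coneAngle r₀ x z ≤ coneAngle r₀ x y + coneAngle r₀ y z :=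
    coneAngle_triangle h0.le
  have c : ∀ x y : Z, coneAngle r₀ x y = coneAngle r₀ y x := coneAngle_comm r₀
  have short : ∀ x y : Z, coneAngle r₀ x y < π → coneAngle r₀ x y * sinh r₀ = dist x y := by
    intro x y hxy
    unfold coneAngle at hxy ⊢
    rw [min_eq_right (by by_contra hlt; exact absurd (min_eq_left (not_le.1 hlt).le) hxy.ne),
      div_mul_cancel₀ _ hs.ne']
  have le : ∀ x y : Z, coneAngle r₀ x y * sinh r₀ ≤ dist x y := fun x y =>
    (mul_le_mul_of_nonneg_right (min_le_right _ _) hs.le).trans_eq (div_mul_cancel₀ _ hs.ne')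
  -- Each side angle is at most the sum of the other three, hence below half the total, hence below
  -- `π`. Diagonals may be truncated, but for them the inequality `le` suffices.
  have a12 := short p₁.1 p₂.1 (by
    linarith [tri p₁.1 p₄.1 p₂.1, tri p₄.1 p₃.1 p₂.1, c p₁.1 p₄.1, c p₄.1 p₃.1, c p₃.1 p₂.1])
  have a23 := short p₂.1 p₃.1 (by
    linarith [tri p₂.1 p₁.1 p₃.1, tri p₁.1 p₄.1 p₃.1, c p₂.1 p₁.1, c p₁.1 p₄.1, c p₄.1 p₃.1])
  have a34 := short p₃.1 p₄.1 (by
    linarith [tri p₃.1 p₂.1 p₄.1, tri p₂.1 p₁.1 p₄.1, c p₃.1 p₂.1, c p₂.1 p₁.1, c p₁.1 p₄.1])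
  have a41 := short p₄.1 p₁.1 (by
    linarith [tri p₄.1 p₃.1 p₁.1, tri p₃.1 p₂.1 p₁.1, c p₄.1 p₃.1, c p₃.1 p₂.1, c p₂.1 p₁.1])
  have hlt := mul_lt_mul_of_pos_right h hs
  have four := hZ p₁.1 p₂.1 p₃.1 p₄.1 (by linarith)
  have a13 := le p₁.1 p₃.1
  have a24 := le p₂.1 p₄.1
  have hη : 0 ≤ δ / sinh r₀ := div_nonneg hδ hs.le
  have e : δ = δ / sinh r₀ * sinh r₀ := (div_mul_cancel₀ _ hs.ne').symm
  have e' : sinh r₀ * (δ / sinh r₀) = δ := mul_div_cancel₀ _ hs.ne'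
  rw [← max_add_add_right, le_max_iff] at four
  rcases four with four | four
  -- Exchanging the second and fourth vertices swaps the two pairs of opposite sides.
  · have k := coneDist_four_point_of_angle_le p₁ p₄ p₃ p₂ hη (by
      refine le_of_mul_le_mul_right ?_ hs
      rw [c p₄.1 p₂.1, c p₄.1 p₃.1]
      linarith)
    rw [coneDist_comm p₄ p₂, coneDist_comm p₃ p₂, coneDist_comm p₄ p₃, e', max_comm] at k
    exact k
  · have k := coneDist_four_point_of_angle_le p₁ p₂ p₃ p₄ hη (by
      refine le_of_mul_le_mul_right ?_ hs
      rw [c p₁.1 p₄.1]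
      rw [dist_comm p₁.1 p₄.1] at four
      linarith)
    rwa [e'] at k

end ConeDist

/-! ### Quotients -/

/-- Doubling and cancelling the distances to the base point `t` turns the minimum of Gromov products
into a maximum of sums of opposite sides. -/
theorem isHyperbolic_iff {δ : ℝ} {X : Type*} [PseudoMetricSpace X] :
    IsHyperbolic δ X ↔ ∀ x y z t : X, dist x z + dist y t ≤
      max (dist x y + dist z t) (dist x t + dist y z) + 2 * δ := by
  refine forall_congr' fun x => forall_congr' fun y => forall_congr' fun z =>
    forall_congr' fun t => ?_
  unfold gromovProduct
  rw [dist_comm t x, dist_comm t y, dist_comm t z, sub_le_iff_le_add, min_le_iff,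
    ← max_add_add_right, le_max_iff]
  refine or_congr ⟨fun h => ?_, fun h => ?_⟩ ⟨fun h => ?_, fun h => ?_⟩ <;> linarith

section Quotient

variable {G X : Type*} [Group G] [MulAction G X]

theorem OrbitSpace.exists_mk (p : OrbitSpace G X) : ∃ x : X, OrbitSpace.mk G x = p :=
  Quotient.exists_rep p

theorem OrbitSpace.exists_smul_of_mk_eq {x y : X} (h : OrbitSpace.mk G x = OrbitSpace.mk G y) :
    ∃ g : G, g • y = x :=
  Quotient.exact h

theorem OrbitSpace.mk_smul (g : G) (x : X) : OrbitSpace.mk G (g • x) = OrbitSpace.mk G x :=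
  Quotient.sound ⟨g, rfl⟩

variable [PseudoMetricSpace X] [IsIsometricSMul G X]

theorem OrbitSpace.dist_mk_le (x y : X) :
    dist (OrbitSpace.mk G x) (OrbitSpace.mk G y) ≤ dist x y := by
  rw [OrbitSpace.dist_mk]
  exact (ciInf_le (orbit_dist_bddBelow x y) 1).trans_eq (by rw [one_smul])

theorem OrbitSpace.exists_dist_lt (x : X) (q : OrbitSpace G X) {η : ℝ} (hη : 0 < η) :
    ∃ y : X, OrbitSpace.mk G y = q ∧ dist x y < dist (OrbitSpace.mk G x) q + η := by
  obtain ⟨y, rfl⟩ := OrbitSpace.exists_mk q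
  obtain ⟨g, hg⟩ := exists_lt_of_ciInf_lt
    (lt_add_of_pos_right (⨅ g : G, dist x (g • y)) hη)
  exact ⟨g • y, OrbitSpace.mk_smul g y, hg⟩

/-- If nontrivial elements move points by at least `L`, then quadrilaterals of perimeter less
than `L` in the quotient of a hyperbolic space satisfy the four point inequality. -/
theorem OrbitSpace.four_point {δ L : ℝ} (hX : IsHyperbolic δ X)
    (hL : ∀ g : G, g ≠ 1 → ∀ x : X, L ≤ dist x (g • x)) (p₁ p₂ p₃ p₄ : OrbitSpace G X)
    (h : dist p₁ p₂ + dist p₂ p₃ + dist p₃ p₄ + dist p₄ p₁ < L) :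
    dist p₁ p₃ + dist p₂ p₄ ≤
      max (dist p₁ p₂ + dist p₃ p₄) (dist p₁ p₄ + dist p₂ p₃) + 2 * δ := by
  refine le_of_forall_pos_le_add fun ε hε => ?_
  -- Quotient distances need not be attained, so each lifted side may lose `η`: four sides must keep
  -- the perimeter at most `L`, and a pair of opposite sides must cost at most `ε`.
  obtain ⟨η, hη, hη₁, hη₂⟩ : ∃ η > 0, 2 * η ≤ ε ∧
      dist p₁ p₂ + dist p₂ p₃ + dist p₃ p₄ + dist p₄ p₁ + 4 * η ≤ L := by
    refine ⟨min (ε / 2) ((L - (dist p₁ p₂ + dist p₂ p₃ + dist p₃ p₄ + dist p₄ p₁)) / 4),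
      lt_min (by linarith) (by linarith), ?_, ?_⟩
    · linarith [min_le_left (ε / 2)
        ((L - (dist p₁ p₂ + dist p₂ p₃ + dist p₃ p₄ + dist p₄ p₁)) / 4)]
    · linarith [min_le_right (ε / 2)
        ((L - (dist p₁ p₂ + dist p₂ p₃ + dist p₃ p₄ + dist p₄ p₁)) / 4)]
  obtain ⟨x₁, rfl⟩ := OrbitSpace.exists_mk p₁
  obtain ⟨x₂, rfl, h12⟩ := OrbitSpace.exists_dist_lt x₁ p₂ hη
  obtain ⟨x₃, rfl, h23⟩ := OrbitSpace.exists_dist_lt x₂ p₃ hη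
  obtain ⟨x₄, rfl, h34⟩ := OrbitSpace.exists_dist_lt x₃ p₄ hη
  obtain ⟨x₅, hx₅, h45⟩ := OrbitSpace.exists_dist_lt x₄ (OrbitSpace.mk G x₁) hη
  obtain ⟨g, rfl⟩ := OrbitSpace.exists_smul_of_mk_eq hx₅
  -- The lifted path from `x₁` to `g • x₁` is shorter than `L`, so it closes up.
  have hg : g = 1 := by
    by_contra hne
    have := hL g hne x₁
    linarith [dist_triangle x₁ x₂ (g • x₁), dist_triangle x₂ x₃ (g • x₁),
      dist_triangle x₃ x₄ (g • x₁)]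
  rw [hg, one_smul, dist_comm x₄] at h45
  rw [dist_comm (OrbitSpace.mk G x₄)] at h45
  have four := isHyperbolic_iff.1 hX x₁ x₂ x₃ x₄
  have k13 := OrbitSpace.dist_mk_le (G := G) x₁ x₃
  have k24 := OrbitSpace.dist_mk_le (G := G) x₂ x₄
  have hmax := max_le_max (add_le_add h12.le h34.le) (add_le_add h45.le h23.le)
  have e : ∀ a b : ℝ, a + η + (b + η) = a + b + 2 * η := fun a b => by ring
  rw [e, e, max_add_add_right] at hmax
  linarith

end Quotient

/-- The quotient of the cone over `Y` is the cone over the quotient of `Y`. -/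
theorem dist_mk_cone_mk {r₀ : ℝ} (h0 : 0 < r₀) {H Y : Type*} [Group H] [MetricSpace Y]
    [MulAction H Y] [IsIsometricSMul H Y] (y y' : Y) (r r' : Icc (0 : ℝ) r₀) :
    dist (OrbitSpace.mk H (Cone.mk y r)) (OrbitSpace.mk H (Cone.mk y' r')) =
      coneDist (OrbitSpace.mk H y, r) (OrbitSpace.mk H y', r') := by
  have hs : 0 < sinh r₀ := sinh_pos_iff.2 h0
  rw [OrbitSpace.dist_mk]
  refine le_antisymm (le_of_forall_pos_le_add fun ε hε => ?_) (le_ciInf fun g => ?_)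
  -- A nearly optimal translate in `Y` is nearly optimal in the cone, since excess `ε` in the base
  -- costs at most `ε` there.
  · obtain ⟨z, hz, hlt⟩ := OrbitSpace.exists_dist_lt y (OrbitSpace.mk H y') hε
    obtain ⟨g, rfl⟩ := OrbitSpace.exists_smul_of_mk_eq hz
    refine (ciInf_le (orbit_dist_bddBelow _ _) g).trans ?_
    have hη : 0 ≤ ε / sinh r₀ := div_nonneg hε.le hs.le
    have k := arcosh_coshSide_le_add (θ := coneAngle r₀ (OrbitSpace.mk H y) (OrbitSpace.mk H y'))
      (φ := coneAngle r₀ y (g • y')) r.2.1 r.2.2 r'.2.1 (coneAngle_nonneg h0.le _ _)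
      (min_le_left _ _) hη (by
        rw [abs_of_nonneg (coneAngle_nonneg h0.le _ _)]
        unfold coneAngle
        rw [← min_add_add_right, ← add_div]
        exact min_le_min (by linarith) (div_le_div_of_nonneg_right hlt.le hs.le))
    rwa [mul_div_cancel₀ _ hs.ne'] at k
  · refine arcosh_coshSide_le_of_cos_le r.2.1 r'.2.1 (cos_le_cos_of_nonneg_of_le_pi
      (coneAngle_nonneg h0.le _ _) (min_le_left _ _) (min_le_min le_rfl
        (div_le_div_of_nonneg_right ?_ hs.le)))
    rw [← OrbitSpace.mk_smul g y']
    exact OrbitSpace.dist_mk_le _ _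

theorem le_dist_smul_of_lt_injectivityRadius {H X : Type*} [Group H] [PseudoMetricSpace X]
    [SMul H X] {L : ℝ} (h : ENNReal.ofReal L < injectivityRadius H X) {g : H} (hg : g ≠ 1)
    (x : X) : L ≤ dist x (g • x) := by
  have h1 : injectivityRadius H X ≤ edist x (g • x) := (iInf₂_le g hg).trans (iInf_le _ x)
  rw [edist_dist] at h1
  exact (ENNReal.ofReal_le_ofReal_iff dist_nonneg).1 (h.le.trans h1)

theorem IsHyperbolic.orbitSpace_cone {r₀ δ : ℝ} (h0 : 0 < r₀) (hδ : 0 ≤ δ) {H Y : Type*}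
    [Group H] [MetricSpace Y] [MulAction H Y] [IsIsometricSMul H Y] (hY : IsHyperbolic δ Y)
    (hL : ENNReal.ofReal (2 * π * sinh r₀) < injectivityRadius H Y) :
    IsHyperbolic (log 3 + δ) (OrbitSpace H (Cone r₀ Y)) := by
  have rep : ∀ p : OrbitSpace H (Cone r₀ Y), ∃ (y : Y) (r : Icc (0 : ℝ) r₀),
      OrbitSpace.mk H (Cone.mk y r) = p := by
    rintro ⟨⟨y, r⟩⟩
    exact ⟨y, r, rfl⟩
  rw [isHyperbolic_iff]
  intro p₁ p₂ p₃ p₄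
  obtain ⟨y₁, r₁, rfl⟩ := rep p₁
  obtain ⟨y₂, r₂, rfl⟩ := rep p₂
  obtain ⟨y₃, r₃, rfl⟩ := rep p₃
  obtain ⟨y₄, r₄, rfl⟩ := rep p₄
  simp only [dist_mk_cone_mk h0]
  exact coneDist_four_point h0 hδ (OrbitSpace.four_point hY
    fun g hg x => le_dist_smul_of_lt_injectivityRadius hL hg x) _ _ _ _

end HypCone

/-- The subset `Y` of `X` stabilized by `H` is bundled as a `SubMulAction`. -/
theorem mainTheorem7 (r₀ : ℝ) (hr₀ : 0 < r₀) (ε : ℝ) (hε : 0 < ε) :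
    ∃ δ : ℝ, 0 < δ ∧
      ∀ (X : Type*) [MetricSpace X] (H : Type*) [Group H] [MulAction H X] [IsIsometricSMul H X]
        (Y : SubMulAction H X),
        HypCone.IsGeodesicSpace X → HypCone.IsHyperbolic δ X →
        HypCone.IsQuasiConvex (10 * δ) (Y : Set X) →
        ENNReal.ofReal (2 * Real.pi * Real.sinh r₀) < HypCone.injectivityRadius H Y →
        HypCone.IsHyperbolic (Real.log 3 + ε) (HypCone.OrbitSpace H (HypCone.Cone r₀ Y)) := by
  refine ⟨ε, hε, fun X _ H _ _ _ Y _ hX _ hL => ?_⟩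
  -- The four-point inequality restricts to a subset with the induced metric.
  exact HypCone.IsHyperbolic.orbitSpace_cone hr₀ hε.le (fun x y z t => hX x y z t) hL
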